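/- Let $n\ge 2$ and let $p:\mathbb R^n\setminus\{0\}\to\mathbb R$ be a positive $C^\infty$ function that is positively homogeneous of degree $1$, i.e. $p(\lambda\xi)=\lambda p(\xi)$ for all $\lambda>0$ and $\xi\in\mathbb R^n\setminus\{0\}$. For any positive $C^\infty$ function $q$ on $\mathbb R^n\setminus\{0\}$ that is positively homogeneous of degree $1$, put $$\Sigma_q=\{\xi\in\mathbb R^n\setminus\{0\}:\ q(\xi)=1\},\qquad \Sigma_q^*=\{\nabla q(\xi):\ \xi\in\Sigma_q\}.$$ Assume that the Gaussian (Gauss–Kronecker) curvature of the hypersurface $\Sigma_p$ never vanishes. Then there exists a positive $C^\infty$ function $p^*:\mathbb R^n\setminus\{0\}\to\mathbb R$, positively homogeneous of degree $1$, such that $$\Sigma_p^*=\Sigma_{p^*},\qquad \Sigma_{p^*}^*=\Sigma_p,$$ and such that the Gaussian curvature of the hypersurface $\Sigma_{p^*}$ never vanishes. Furthermore, $\nabla p:\Sigma_p\to\Sigma_{p^*}$ is a $C^\infty$-diffeomorphism, and $\nabla p^*:\Sigma_{p^*}\to\Sigma_p$ is its inverse. -/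

import Mathlib

open scoped ContDiff InnerProductSpace

noncomputable section

/-- `p` is a positive, `C^∞` and positively homogeneous function of degree `1` on `ℝⁿ \ {0}`.
The value of `p` at the origin is irrelevant. -/
structure IsPosHomSmooth {n : ℕ} (p : EuclideanSpace ℝ (Fin n) → ℝ) : Prop where
  smooth : ContDiffOn ℝ ∞ p {0}ᶜ
  pos : ∀ ξ, ξ ≠ 0 → 0 < p ξ
  homogeneous : ∀ t : ℝ, 0 < t → ∀ ξ, ξ ≠ 0 → p (t • ξ) = t * p ξ

/-- The hypersurface `Σ_q = {ξ ∈ ℝⁿ \ {0} ; q(ξ) = 1}`. -/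
def unitLevelSet {n : ℕ} (q : EuclideanSpace ℝ (Fin n) → ℝ) : Set (EuclideanSpace ℝ (Fin n)) :=
  {ξ | ξ ≠ 0 ∧ q ξ = 1}

/-- The dual set `Σ_q^* = {∇q(ξ) ; ξ ∈ Σ_q}`. -/
def dualLevelSet {n : ℕ} (q : EuclideanSpace ℝ (Fin n) → ℝ) : Set (EuclideanSpace ℝ (Fin n)) :=
  gradient q '' unitLevelSet q

/-- The Gauss map `ν = ∇q / |∇q|`: the unit normal field of the level hypersurfaces of `q`
at points where `∇q ≠ 0`. -/
def gaussMap {n : ℕ} (q : EuclideanSpace ℝ (Fin n) → ℝ) (ξ : EuclideanSpace ℝ (Fin n)) :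
    EuclideanSpace ℝ (Fin n) :=
  ‖gradient q ξ‖⁻¹ • gradient q ξ

/-- The tangent space at `ξ` of the level hypersurface of `q` through `ξ` (where `∇q(ξ) ≠ 0`):
the orthogonal complement of `∇q(ξ)`. -/
def levelTangentSpace {n : ℕ} (q : EuclideanSpace ℝ (Fin n) → ℝ)
    (ξ : EuclideanSpace ℝ (Fin n)) : Submodule ℝ (EuclideanSpace ℝ (Fin n)) :=
  (Submodule.span ℝ {gradient q ξ})ᗮ

/-- The shape operator (Weingarten map) `v ↦ -dν_ξ(v)` of the level hypersurface of `q` through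
`ξ`, an endomorphism of the tangent space. As `|ν| = 1`, the vector `dν_ξ(v)` is already tangent;
the orthogonal projection only serves to give the map the tangent space as its codomain. -/
def shapeOperator {n : ℕ} (q : EuclideanSpace ℝ (Fin n) → ℝ) (ξ : EuclideanSpace ℝ (Fin n)) :
    levelTangentSpace q ξ →ₗ[ℝ] levelTangentSpace q ξ :=
  -((levelTangentSpace q ξ).orthogonalProjectionOnto.toLinearMap ∘ₗ
      (fderiv ℝ (gaussMap q) ξ).toLinearMap ∘ₗ (levelTangentSpace q ξ).subtype)

/-- The Gaussian (Gauss–Kronecker) curvature at `ξ` of the level hypersurface of `q` through `ξ`,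
oriented by `ν`: the determinant of the shape operator, i.e. the product of the principal
curvatures. -/
def gaussianCurvature {n : ℕ} (q : EuclideanSpace ℝ (Fin n) → ℝ)
    (ξ : EuclideanSpace ℝ (Fin n)) : ℝ :=
  LinearMap.det (shapeOperator q ξ)

/-- A map is `C^∞` on a subset `X` of Euclidean space if near every point of `X` it agrees on `X`
with a `C^∞` map defined on an open subset of the ambient space. If `X` is an embedded
submanifold, this is smoothness on the manifold `X`. -/
def IsSmoothOnSubset {n m : ℕ} (f : EuclideanSpace ℝ (Fin n) → EuclideanSpace ℝ (Fin m))
    (X : Set (EuclideanSpace ℝ (Fin n))) : Prop :=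
  ∀ x ∈ X, ∃ (U : Set (EuclideanSpace ℝ (Fin n)))
    (F : EuclideanSpace ℝ (Fin n) → EuclideanSpace ℝ (Fin m)),
    IsOpen U ∧ x ∈ U ∧ ContDiffOn ℝ ∞ F U ∧ Set.EqOn f F (U ∩ X)

/-- `f : X → Y` is a `C^∞`-diffeomorphism between subsets of Euclidean spaces, and `g : Y → X` is
its inverse. -/
structure IsDiffeoWithInverse {n m : ℕ}
    (f : EuclideanSpace ℝ (Fin n) → EuclideanSpace ℝ (Fin m))
    (g : EuclideanSpace ℝ (Fin m) → EuclideanSpace ℝ (Fin n))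
    (X : Set (EuclideanSpace ℝ (Fin n))) (Y : Set (EuclideanSpace ℝ (Fin m))) : Prop where
  mapsTo : Set.MapsTo f X Y
  mapsTo_inv : Set.MapsTo g Y X
  invOn : Set.InvOn g f X Y
  smooth : IsSmoothOnSubset f X
  smooth_inv : IsSmoothOnSubset g Y

end

/-! The Legendre map `L = p ∇p = ∇(p²/2)` is 1-homogeneous on `ℝⁿ \ {0}` and equals `∇p` on `Σ_p`.
By Euler's identity the Hessian of `p` takes values in `ξ^⊥`, while `⟪∇p, ξ⟫ = p > 0`; hence nonzero
curvature at `ξ` means exactly that `DL(ξ)` is injective (`gaussianCurvature_ne_zero_iff`).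

`DL` is symmetric, and positive definite where `p` is minimal on the unit sphere. Nondegeneracy and
connectedness of `ℝⁿ \ {0}` (here `n ≥ 2` enters) spread this to every point
(`fderiv_legendreMap_pos`), so `L` is injective by strict monotonicity. It is onto because `⟪η, ·⟫ /
p` attains a maximum. By the inverse function theorem `L⁻¹` is smooth.

Put `p* = p ∘ L⁻¹`. Differentiating `⟪L⁻¹η, η⟫ = p*(η)²` shows that `L⁻¹` is the Legendre map of
`p*` (`legendreMap_dualFunction`). Restriction to the unit level sets gives the theorem. -/

open Filter Topology Set
open scoped ContDiff InnerProductSpace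

/-! ### Second-order calculus. -/

section Gradient

variable {F : Type*} [NormedAddCommGroup F] [InnerProductSpace ℝ F] [CompleteSpace F]

theorem ContDiffAt.gradient_infty {f : F → ℝ} {x : F} (hf : ContDiffAt ℝ ∞ f x) :
    ContDiffAt ℝ ∞ (gradient f) x :=
  (InnerProductSpace.toDual ℝ F).symm.toContinuousLinearEquiv.contDiff.contDiffAt.comp x
    (hf.fderiv_right (m := ∞) (by simp))

/-- The derivative of a gradient field is self-adjoint. -/
theorem ContDiffAt.inner_fderiv_gradient_comm {f : F → ℝ} {x : F} (hf : ContDiffAt ℝ ∞ f x)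
    (v w : F) :
    ⟪fderiv ℝ (gradient f) x v, w⟫_ℝ = ⟪fderiv ℝ (gradient f) x w, v⟫_ℝ := by
  have hsymm : IsSymmSndFDerivAt ℝ f x := hf.isSymmSndFDerivAt (by simp; norm_cast)
  have key : ∀ u : F, fderiv ℝ (gradient f) x u =
      (InnerProductSpace.toDual ℝ F).symm (fderiv ℝ (fderiv ℝ f) x u) := by
    intro u
    have h : HasFDerivAt (fderiv ℝ f) (fderiv ℝ (fderiv ℝ f) x) x :=
      ((hf.fderiv_right (m := ∞) (by simp)).differentiableAt (by simp)).hasFDerivAt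
    have h' := ((InnerProductSpace.toDual ℝ F).symm.toContinuousLinearEquiv
      |>.toContinuousLinearMap).hasFDerivAt.comp x h
    exact congrArg (fun L => L u) h'.fderiv
  simp only [key, InnerProductSpace.toDual_symm_apply]
  exact hsymm v w

end Gradient

/-- The second-order necessary condition for a local minimum. -/
theorem IsLocalMin.second_deriv_nonneg {φ ψ : ℝ → ℝ} {a c : ℝ} (hmin : IsLocalMin φ a)
    (hφ : ∀ᶠ t in 𝓝 a, HasDerivAt φ (ψ t) t) (hψ : HasDerivAt ψ c a) : 0 ≤ c := by
  by_contra! hc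
  have hd : deriv φ =ᶠ[𝓝 a] ψ := hφ.mono fun t ht => ht.deriv
  -- A negative second derivative would also make `a` a local maximum, so `φ` would be locally
  -- constant and `c = 0`.
  have hmax : IsLocalMax φ a := by
    apply isLocalMax_of_deriv_deriv_neg
    · rw [hd.deriv_eq, hψ.deriv]; exact hc
    · exact hmin.deriv_eq_zero
    · exact hφ.self_of_nhds.continuousAt
  have hconst : φ =ᶠ[𝓝 a] fun _ => φ a := by
    filter_upwards [hmin, hmax] with t h1 h2 using le_antisymm h2 h1
  have h0 : ψ =ᶠ[𝓝 a] fun _ => 0 := by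
    refine hd.symm.trans (hconst.deriv.trans ?_)
    simp
  have := (hψ.congr_of_eventuallyEq h0.symm).unique (hasDerivAt_const a (0 : ℝ))
  exact hc.ne this

/-! ### The Legendre map and its relation to curvature. -/

variable {n : ℕ}

/-- The gradient of `q² / 2` away from the origin. -/
noncomputable def legendreMap (q : EuclideanSpace ℝ (Fin n) → ℝ) (ξ : EuclideanSpace ℝ (Fin n)) : EuclideanSpace ℝ (Fin n) := q ξ • gradient q ξ

namespace IsPosHomSmooth

variable {q : EuclideanSpace ℝ (Fin n) → ℝ} (hq : IsPosHomSmooth q) {ξ : EuclideanSpace ℝ (Fin n)} (hξ : ξ ≠ 0)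
include hq hξ

theorem contDiffAt : ContDiffAt ℝ ∞ q ξ :=
  hq.smooth.contDiffAt (isOpen_compl_singleton.mem_nhds hξ)

theorem hasFDerivAt : HasFDerivAt q (fderiv ℝ q ξ) ξ :=
  ((hq.contDiffAt hξ).differentiableAt (by simp)).hasFDerivAt

theorem hasFDerivAt_gradient : HasFDerivAt (gradient q) (fderiv ℝ (gradient q) ξ) ξ :=
  ((hq.contDiffAt hξ).gradient_infty.differentiableAt (by simp)).hasFDerivAt

/-- Euler's identity. -/
theorem inner_gradient_self : ⟪gradient q ξ, ξ⟫_ℝ = q ξ := by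
  rw [inner_gradient_left]
  have h1 : HasDerivAt (fun t : ℝ => t • ξ) ξ 1 := by
    simpa using (hasDerivAt_id (1 : ℝ)).smul_const ξ
  have h2 : HasDerivAt (fun t : ℝ => q (t • ξ)) (fderiv ℝ q ξ ξ) 1 := by
    have h := hq.hasFDerivAt hξ
    rw [← one_smul ℝ ξ] at h
    simpa [Function.comp_def] using! h.comp_hasDerivAt 1 h1
  have h3 : HasDerivAt (fun t : ℝ => t * q ξ) (q ξ) 1 := by
    simpa using (hasDerivAt_id (1 : ℝ)).mul_const (q ξ)
  refine h2.unique (h3.congr_of_eventuallyEq ?_)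
  filter_upwards [lt_mem_nhds (zero_lt_one (α := ℝ))] with t ht
  exact hq.homogeneous t ht ξ hξ

theorem gradient_ne_zero : gradient q ξ ≠ 0 := by
  intro h
  have := hq.inner_gradient_self hξ
  rw [h, inner_zero_left] at this
  exact (hq.pos ξ hξ).ne this

theorem gradient_smul {t : ℝ} (ht : 0 < t) : gradient q (t • ξ) = gradient q ξ := by
  have htξ : t • ξ ≠ 0 := smul_ne_zero ht.ne' hξ
  refine ext_inner_right ℝ fun v => ?_
  rw [inner_gradient_left, inner_gradient_left]
  have h1 : HasFDerivAt (fun x : EuclideanSpace ℝ (Fin n) => q (t • x)) (fderiv ℝ q (t • ξ) ∘L (t • .id ℝ (EuclideanSpace ℝ (Fin n)))) ξ :=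
    (hq.hasFDerivAt htξ).comp ξ ((hasFDerivAt_id ξ).const_smul t)
  have h2 : HasFDerivAt (fun x : EuclideanSpace ℝ (Fin n) => t * q x) (t • fderiv ℝ q ξ) ξ :=
    (hq.hasFDerivAt hξ).const_mul t
  have h3 := h1.unique (h2.congr_of_eventuallyEq (by
    filter_upwards [isOpen_compl_singleton.mem_nhds hξ] with x hx
    exact hq.homogeneous t ht x hx))
  have h4 := congrArg (fun L => L v) h3
  simpa [ht.ne'] using h4

/-- Differentiate Euler's identity: the terms `⟪∇q, v⟫` cancel. Pairing with `ξ` therefore separates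
Hessian terms from multiples of `∇q`. -/
theorem inner_fderiv_gradient_self (v : EuclideanSpace ℝ (Fin n)) : ⟪fderiv ℝ (gradient q) ξ v, ξ⟫_ℝ = 0 := by
  have h1 := (hq.hasFDerivAt_gradient hξ).inner ℝ (hasFDerivAt_id ξ)
  have h2 := h1.unique ((hq.hasFDerivAt hξ).congr_of_eventuallyEq (by
    filter_upwards [isOpen_compl_singleton.mem_nhds hξ] with x hx
    exact hq.inner_gradient_self hx))
  have h3 := congrArg (fun L => L v) h2
  have h4 : ⟪gradient q ξ, v⟫_ℝ + ⟪fderiv ℝ (gradient q) ξ v, ξ⟫_ℝ = fderiv ℝ q ξ v := by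
    simpa [fderivInnerCLM_apply] using h3
  rw [inner_gradient_left] at h4
  linarith

theorem contDiffAt_legendreMap : ContDiffAt ℝ ∞ (legendreMap q) ξ :=
  (hq.contDiffAt hξ).smul (hq.contDiffAt hξ).gradient_infty

theorem hasFDerivAt_legendreMap :
    HasFDerivAt (legendreMap q) (fderiv ℝ (legendreMap q) ξ) ξ :=
  ((hq.contDiffAt_legendreMap hξ).differentiableAt (by simp)).hasFDerivAt

theorem fderiv_legendreMap_apply (v : EuclideanSpace ℝ (Fin n)) : fderiv ℝ (legendreMap q) ξ v =
    q ξ • fderiv ℝ (gradient q) ξ v + ⟪gradient q ξ, v⟫_ℝ • gradient q ξ := by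
  have h : HasFDerivAt (legendreMap q) _ ξ :=
    (hq.hasFDerivAt hξ).smul (hq.hasFDerivAt_gradient hξ)
  rw [h.fderiv, inner_gradient_left]
  simp

theorem inner_fderiv_legendreMap_comm (v w : EuclideanSpace ℝ (Fin n)) :
    ⟪fderiv ℝ (legendreMap q) ξ v, w⟫_ℝ = ⟪fderiv ℝ (legendreMap q) ξ w, v⟫_ℝ := by
  rw [hq.fderiv_legendreMap_apply hξ, hq.fderiv_legendreMap_apply hξ]
  simp only [inner_add_left, real_inner_smul_left,
    (hq.contDiffAt hξ).inner_fderiv_gradient_comm v w]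
  ring

theorem inner_legendreMap_self : ⟪legendreMap q ξ, ξ⟫_ℝ = q ξ ^ 2 := by
  rw [legendreMap, real_inner_smul_left, hq.inner_gradient_self hξ, sq]

theorem legendreMap_ne_zero : legendreMap q ξ ≠ 0 :=
  smul_ne_zero (hq.pos ξ hξ).ne' (hq.gradient_ne_zero hξ)

theorem legendreMap_smul {t : ℝ} (ht : 0 < t) :
    legendreMap q (t • ξ) = t • legendreMap q ξ := by
  rw [legendreMap, legendreMap, hq.gradient_smul hξ ht, hq.homogeneous t ht ξ hξ, mul_smul]

/-- The kernel of the derivative of the Legendre map consists of the tangent vectors to the level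
set that are annihilated by the Hessian. -/
theorem fderiv_legendreMap_apply_eq_zero_iff (v : EuclideanSpace ℝ (Fin n)) : fderiv ℝ (legendreMap q) ξ v = 0 ↔
    ⟪gradient q ξ, v⟫_ℝ = 0 ∧ fderiv ℝ (gradient q) ξ v = 0 := by
  have hpos := hq.pos ξ hξ
  rw [hq.fderiv_legendreMap_apply hξ]
  constructor
  · intro h
    have h1 := congrArg (fun w => ⟪w, ξ⟫_ℝ) h
    simp only [inner_add_left, real_inner_smul_left, hq.inner_fderiv_gradient_self hξ,
      hq.inner_gradient_self hξ, inner_zero_left, mul_zero, zero_add] at h1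
    have h2 : ⟪gradient q ξ, v⟫_ℝ = 0 := (mul_eq_zero.1 h1).resolve_right hpos.ne'
    refine ⟨h2, ?_⟩
    rw [h2, zero_smul, add_zero] at h
    exact (smul_eq_zero.1 h).resolve_left hpos.ne'
  · rintro ⟨h1, h2⟩
    simp [h1, h2]

/-- The value of `c` is irrelevant: projection to the tangent space kills multiples of `∇q`. -/
theorem fderiv_gaussMap_apply {v : EuclideanSpace ℝ (Fin n)} : ∃ c : ℝ, fderiv ℝ (gaussMap q) ξ v =
    ‖gradient q ξ‖⁻¹ • fderiv ℝ (gradient q) ξ v + c • gradient q ξ := by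
  have hg := hq.gradient_ne_zero hξ
  have hn : DifferentiableAt ℝ (fun x => ‖gradient q x‖⁻¹) ξ :=
    ((hq.hasFDerivAt_gradient hξ).differentiableAt.norm ℝ hg).inv (norm_ne_zero_iff.2 hg)
  have h : HasFDerivAt (gaussMap q) _ ξ := hn.hasFDerivAt.smul (hq.hasFDerivAt_gradient hξ)
  exact ⟨fderiv ℝ (fun x => ‖gradient q x‖⁻¹) ξ v, by rw [h.fderiv]; simp⟩

theorem shapeOperator_apply_eq_zero_iff (v : levelTangentSpace q ξ) :
    shapeOperator q ξ v = 0 ↔ fderiv ℝ (gradient q) ξ v = 0 := by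
  have hg := hq.gradient_ne_zero hξ
  obtain ⟨c, hc⟩ := hq.fderiv_gaussMap_apply hξ (v := v)
  have h1 : shapeOperator q ξ v = 0 ↔
      fderiv ℝ (gaussMap q) ξ v ∈ Submodule.span ℝ {gradient q ξ} := by
    have h2 : shapeOperator q ξ v =
        -(levelTangentSpace q ξ).orthogonalProjectionOnto (fderiv ℝ (gaussMap q) ξ v) := rfl
    have h3 : (levelTangentSpace q ξ)ᗮ = Submodule.span ℝ {gradient q ξ} :=
      Submodule.orthogonal_orthogonal _
    rw [h2, neg_eq_zero, Submodule.orthogonalProjectionOnto_eq_zero_iff, h3]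
  rw [h1, hc, Submodule.mem_span_singleton]
  constructor
  · rintro ⟨a, ha⟩
    have h2 := congrArg (fun w => ⟪w, ξ⟫_ℝ) ha
    simp only [inner_add_left, real_inner_smul_left, hq.inner_fderiv_gradient_self hξ,
      hq.inner_gradient_self hξ, mul_zero, zero_add] at h2
    have hac : a = c := mul_right_cancel₀ (hq.pos ξ hξ).ne' h2
    rw [hac, right_eq_add] at ha
    exact (smul_eq_zero.1 ha).resolve_left (inv_ne_zero (norm_ne_zero_iff.2 hg))
  · intro h
    exact ⟨c, by simp [h]⟩

/-- The Gaussian curvature of a level set is nonzero exactly where the Legendre map is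
nondegenerate. -/
theorem gaussianCurvature_ne_zero_iff : gaussianCurvature q ξ ≠ 0 ↔
    ∀ v, fderiv ℝ (legendreMap q) ξ v = 0 → v = 0 := by
  rw [gaussianCurvature, ne_eq, LinearMap.det_eq_zero_iff_ker_ne_bot, not_not,
    LinearMap.ker_eq_bot']
  constructor
  · intro h v hv
    obtain ⟨h1, h2⟩ := (hq.fderiv_legendreMap_apply_eq_zero_iff hξ v).1 hv
    have hmem : v ∈ levelTangentSpace q ξ := Submodule.mem_orthogonal_singleton_iff_inner_right.2 h1
    simpa using h ⟨v, hmem⟩ ((hq.shapeOperator_apply_eq_zero_iff hξ _).2 h2)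
  · intro h v hv
    refine Subtype.ext (h v ((hq.fderiv_legendreMap_apply_eq_zero_iff hξ _).2
      ⟨Submodule.mem_orthogonal_singleton_iff_inner_right.1 v.2, ?_⟩))
    exact (hq.shapeOperator_apply_eq_zero_iff hξ _).1 hv

end IsPosHomSmooth

/-! ### Positive definiteness and bijectivity of the Legendre map. -/

namespace IsPosHomSmooth

variable {p : EuclideanSpace ℝ (Fin n) → ℝ}

/-- At a point of the unit sphere where `p` is minimal, the Hessian of `p² / 2` is positive
definite. -/
theorem exists_fderiv_legendreMap_pos (hp : IsPosHomSmooth p) [NeZero n] :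
    ∃ ξ, ξ ≠ 0 ∧ ∀ v, v ≠ 0 → 0 < ⟪fderiv ℝ (legendreMap p) ξ v, v⟫_ℝ := by
  have hcont : ContinuousOn p (Metric.sphere 0 1) := fun x hx =>
    (hp.contDiffAt (ne_zero_of_mem_unit_sphere ⟨x, hx⟩)).continuousAt.continuousWithinAt
  obtain ⟨ξ, hξ, hmin⟩ := (isCompact_sphere (0 : EuclideanSpace ℝ (Fin n)) 1).exists_isMinOn
    (NormedSpace.sphere_nonempty.2 zero_le_one) hcont
  have hξ0 : ξ ≠ 0 := ne_zero_of_mem_unit_sphere ⟨ξ, hξ⟩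
  have hm : 0 < p ξ := hp.pos ξ hξ0
  have hle : ∀ x, x ≠ 0 → p ξ * ‖x‖ ≤ p x := by
    intro x hx
    have hnx : 0 < ‖x‖ := norm_pos_iff.2 hx
    have h1 : p ξ ≤ p (‖x‖⁻¹ • x) := hmin (by simp [norm_smul, hnx.ne'])
    rw [hp.homogeneous _ (inv_pos.2 hnx) x hx] at h1
    rwa [mul_comm, ← le_inv_mul_iff₀ hnx]
  refine ⟨ξ, hξ0, fun v hv => ?_⟩
  have hline : ∀ t : ℝ, HasDerivAt (fun t : ℝ => ξ + t • v) v t := fun t => by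
    simpa using ((hasDerivAt_id t).smul_const v).const_add ξ
  have hne : ∀ᶠ t : ℝ in 𝓝 0, ξ + t • v ≠ 0 := by
    refine (hline 0).continuousAt.eventually_ne ?_
    simpa using hξ0
  -- By homogeneity `p ≥ p(ξ)‖·‖`, with equality at `ξ`. The second-order condition then bounds the
  -- Hessian of `p²` below by `2 p(ξ)²`.
  have hlocal : IsLocalMin (fun t : ℝ => p (ξ + t • v) ^ 2 - p ξ ^ 2 * ‖ξ + t • v‖ ^ 2) 0 := by
    filter_upwards [hne] with t ht
    have h1 : ‖ξ‖ = 1 := by simpa using hξ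
    have h2 := pow_le_pow_left₀ (by positivity) (hle _ ht) 2
    rw [mul_pow] at h2
    simp only [zero_smul, add_zero, h1]
    linarith
  have hd1 : ∀ᶠ t : ℝ in 𝓝 0,
      HasDerivAt (fun t : ℝ => p (ξ + t • v) ^ 2 - p ξ ^ 2 * ‖ξ + t • v‖ ^ 2)
        (2 * ⟪legendreMap p (ξ + t • v), v⟫_ℝ - p ξ ^ 2 * (2 * ⟪ξ + t • v, v⟫_ℝ)) t := by
    filter_upwards [hne] with t ht
    have h1 := ((hp.hasFDerivAt ht).comp_hasDerivAt t (hline t)).pow 2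
    have h2 := ((hline t).norm_sq).const_mul (p ξ ^ 2)
    have h3 : ⟪legendreMap p (ξ + t • v), v⟫_ℝ = p (ξ + t • v) * fderiv ℝ p (ξ + t • v) v := by
      rw [legendreMap, real_inner_smul_left, inner_gradient_left]
    refine (h1.sub h2).congr_deriv ?_
    rw [h3]
    simp only [Nat.cast_ofNat, Nat.add_one_sub_one, pow_one, Function.comp_apply]
    ring
  have hd2 : HasDerivAt (fun t : ℝ => 2 * ⟪legendreMap p (ξ + t • v), v⟫_ℝ -
      p ξ ^ 2 * (2 * ⟪ξ + t • v, v⟫_ℝ))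
      (2 * ⟪fderiv ℝ (legendreMap p) ξ v, v⟫_ℝ - p ξ ^ 2 * (2 * ⟪v, v⟫_ℝ)) 0 := by
    have hG : HasFDerivAt (legendreMap p) (fderiv ℝ (legendreMap p) ξ) (ξ + (0 : ℝ) • v) := by
      simpa using hp.hasFDerivAt_legendreMap hξ0
    have h1 := ((hG.comp_hasDerivAt 0 (hline 0)).inner ℝ (hasDerivAt_const (0 : ℝ) v)).const_mul 2
    have h2 := (((hline 0).inner ℝ (hasDerivAt_const (0 : ℝ) v)).const_mul 2).const_mul (p ξ ^ 2)
    simpa [Function.comp_def] using! h1.sub h2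
  have h := hlocal.second_deriv_nonneg hd1 hd2
  have hvv : 0 < p ξ ^ 2 * ⟪v, v⟫_ℝ := mul_pos (by positivity) (real_inner_self_pos.2 hv)
  linarith

theorem isOpen_setOf_fderiv_legendreMap_pos (hp : IsPosHomSmooth p) :
    IsOpen {ξ | ξ ≠ 0 ∧ ∀ v, v ≠ 0 → 0 < ⟪fderiv ℝ (legendreMap p) ξ v, v⟫_ℝ} := by
  rw [isOpen_iff_mem_nhds]
  rintro ξ ⟨hξ, hpos⟩
  have hcont : ContinuousAt (fderiv ℝ (legendreMap p)) ξ :=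
    ((hp.contDiffAt_legendreMap hξ).fderiv_right (m := ∞) (by simp)).continuousAt
  have hev : ∀ᶠ x in 𝓝 ξ, ∀ v ∈ Metric.sphere (0 : EuclideanSpace ℝ (Fin n)) 1,
      0 < ⟪fderiv ℝ (legendreMap p) x v, v⟫_ℝ := by
    refine (isCompact_sphere _ _).eventually_forall_of_forall_eventually fun v hv => ?_
    have h1 : ContinuousAt (fun z : EuclideanSpace ℝ (Fin n) × EuclideanSpace ℝ (Fin n) =>
        ⟪fderiv ℝ (legendreMap p) z.1 z.2, z.2⟫_ℝ) (ξ, v) :=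
      ((hcont.comp (x := (ξ, v)) continuousAt_fst).clm_apply continuousAt_snd).inner
        continuousAt_snd
    exact h1.eventually (lt_mem_nhds (hpos v (ne_zero_of_mem_unit_sphere ⟨v, hv⟩)))
  filter_upwards [hev, isOpen_compl_singleton.mem_nhds hξ] with x hx hx0
  refine ⟨hx0, fun v hv => ?_⟩
  have hnv : 0 < ‖v‖ := norm_pos_iff.2 hv
  have h := hx (‖v‖⁻¹ • v) (by simp [norm_smul, hnv.ne'])
  rw [map_smul, real_inner_smul_left, real_inner_smul_right] at h
  exact (mul_pos_iff_of_pos_left (inv_pos.2 hnv)).1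
    ((mul_pos_iff_of_pos_left (inv_pos.2 hnv)).1 h)

theorem isOpen_setOf_fderiv_legendreMap_neg (hp : IsPosHomSmooth p) :
    IsOpen {ξ | ξ ≠ 0 ∧ ∃ v, ⟪fderiv ℝ (legendreMap p) ξ v, v⟫_ℝ < 0} := by
  rw [isOpen_iff_mem_nhds]
  rintro ξ ⟨hξ, v, hv⟩
  have hcont : ContinuousAt (fun x => ⟪fderiv ℝ (legendreMap p) x v, v⟫_ℝ) ξ :=
    (((hp.contDiffAt_legendreMap hξ).fderiv_right (m := ∞) (by simp)).continuousAt.clm_apply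
      continuousAt_const).inner continuousAt_const
  filter_upwards [hcont.eventually (gt_mem_nhds hv), isOpen_compl_singleton.mem_nhds hξ]
    with x hx hx0 using ⟨hx0, v, hx⟩

/-- If the Legendre map is nondegenerate everywhere, then its derivative is positive definite
everywhere. -/
theorem fderiv_legendreMap_pos (hp : IsPosHomSmooth p) (hn : 2 ≤ n)
    (hnd : ∀ ξ, ξ ≠ 0 → ∀ v, fderiv ℝ (legendreMap p) ξ v = 0 → v = 0)
    {ξ : EuclideanSpace ℝ (Fin n)} (hξ : ξ ≠ 0) {v : EuclideanSpace ℝ (Fin n)} (hv : v ≠ 0) :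
    0 < ⟪fderiv ℝ (legendreMap p) ξ v, v⟫_ℝ := by
  have : NeZero n := ⟨by omega⟩
  have hconn : IsPreconnected ({0}ᶜ : Set (EuclideanSpace ℝ (Fin n))) := by
    refine (isConnected_compl_singleton_of_one_lt_rank ?_ 0).isPreconnected
    rw [← Module.finrank_eq_rank, finrank_euclideanSpace_fin]
    exact_mod_cast hn
  obtain ⟨x, hx0, hx⟩ := hp.exists_fderiv_legendreMap_pos
  have hsub := IsPreconnected.subset_left_of_subset_union hp.isOpen_setOf_fderiv_legendreMap_pos
    hp.isOpen_setOf_fderiv_legendreMap_neg ?_ ?_ ⟨x, hx0, hx0, hx⟩ hconn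
  · exact (hsub hξ).2 v hv
  · rw [Set.disjoint_left]
    rintro y ⟨-, hy⟩ ⟨-, w, hw⟩
    rcases eq_or_ne w 0 with rfl | hw0
    · simp at hw
    · exact lt_asymm hw (hy w hw0)
  · intro y hy
    by_cases hneg : ∃ w, ⟪fderiv ℝ (legendreMap p) y w, w⟫_ℝ < 0
    · exact Or.inr ⟨hy, hneg⟩
    push Not at hneg
    refine Or.inl ⟨hy, fun w hw => (hneg w).lt_of_ne' fun h0 => hw (hnd y hy w ?_)⟩
    -- For a symmetric positive semidefinite form an isotropic vector lies in the kernel, which is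
    -- trivial by nondegeneracy.
    let B : LinearMap.BilinForm ℝ (EuclideanSpace ℝ (Fin n)) :=
      (innerₗ _) ∘ₗ (fderiv ℝ (legendreMap p) y).toLinearMap
    have hB : ∀ a b, B a b = ⟪fderiv ℝ (legendreMap p) y a, b⟫_ℝ := fun _ _ => rfl
    have hker := (B.apply_apply_same_eq_zero_iff hneg
      ⟨fun a b => hp.inner_fderiv_legendreMap_comm hy a b⟩).1 h0
    refine ext_inner_right ℝ fun u => ?_
    rw [← hB, LinearMap.mem_ker.1 hker, inner_zero_left, LinearMap.zero_apply]

/-- Along the segment from `y` to `x`, `⟪L, x - y⟫` has positive derivative but equal end values,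
against Rolle. If the segment meets the origin, where `L` is not controlled, Euler's identity is
used instead. -/
theorem legendreMap_injOn (hp : IsPosHomSmooth p)
    (hpos : ∀ ξ, ξ ≠ 0 → ∀ v, v ≠ 0 → 0 < ⟪fderiv ℝ (legendreMap p) ξ v, v⟫_ℝ) :
    InjOn (legendreMap p) {0}ᶜ := by
  intro x hx y hy hxy
  by_contra hne
  have hline : ∀ t : ℝ, HasDerivAt (fun t : ℝ => y + t • (x - y)) (x - y) t := fun t => by
    simpa using ((hasDerivAt_id t).smul_const (x - y)).const_add y
  by_cases hseg : ∀ t ∈ Icc (0 : ℝ) 1, y + t • (x - y) ≠ 0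
  · have hd : ∀ t ∈ Icc (0 : ℝ) 1, HasDerivAt (fun t : ℝ => ⟪legendreMap p (y + t • (x - y)), x - y⟫_ℝ)
        ⟪fderiv ℝ (legendreMap p) (y + t • (x - y)) (x - y), x - y⟫_ℝ t := by
      intro t ht
      have h := ((hp.hasFDerivAt_legendreMap (hseg t ht)).comp_hasDerivAt t (hline t)).inner ℝ
        (hasDerivAt_const t (x - y))
      simpa [Function.comp_def] using! h
    obtain ⟨c, hc, hc0⟩ := exists_hasDerivAt_eq_zero one_pos
      (fun t ht => (hd t ht).continuousAt.continuousWithinAt) (by simp [hxy])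
      (fun t ht => hd t (Ioo_subset_Icc_self ht))
    exact (hpos _ (hseg c (Ioo_subset_Icc_self hc)) _ (sub_ne_zero.2 hne)).ne' hc0
  · push Not at hseg
    obtain ⟨t, ⟨ht0, ht1⟩, ht⟩ := hseg
    -- Pair the common value `L x = L y` with the point `(1 - t) y + t x = 0`.
    have h1 : (1 - t) * p y ^ 2 + t * p x ^ 2 = 0 := by
      rw [← hp.inner_legendreMap_self hx, ← hp.inner_legendreMap_self hy, hxy,
        ← real_inner_smul_right, ← real_inner_smul_right, ← inner_add_right]
      rw [show (1 - t) • y + t • x = y + t • (x - y) by module, ht, inner_zero_right]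
    have h2 := pow_pos (hp.pos x hx) 2
    have h3 := pow_pos (hp.pos y hy) 2
    rcases ht0.eq_or_lt with rfl | ht0
    · simp at h1; exact h3.ne' (by simpa using h1)
    · have := mul_pos ht0 h2
      have := mul_nonneg (sub_nonneg.2 ht1) h3.le
      linarith

/-- Surjectivity of the Legendre map: `η ≠ 0` is attained on the ray through a point of the unit
sphere where `⟨η, ·⟩ / p` is maximal. -/
theorem legendreMap_surjOn (hp : IsPosHomSmooth p) :
    SurjOn (legendreMap p) {0}ᶜ {0}ᶜ := by
  intro η hη
  have hnη : 0 < ‖η‖ := norm_pos_iff.2 hη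
  have hmem : ‖η‖⁻¹ • η ∈ Metric.sphere (0 : EuclideanSpace ℝ (Fin n)) 1 := by
    simp [norm_smul, hnη.ne']
  have hcont : ContinuousOn (fun x => ⟪η, x⟫_ℝ / p x) (Metric.sphere 0 1) := fun x hx => by
    have hx0 : x ≠ 0 := ne_zero_of_mem_unit_sphere ⟨x, hx⟩
    exact ((continuousAt_const.inner continuousAt_id).div (hp.contDiffAt hx0).continuousAt
      (hp.pos x hx0).ne').continuousWithinAt
  obtain ⟨ξ, hξ, hmax⟩ := (isCompact_sphere (0 : EuclideanSpace ℝ (Fin n)) 1).exists_isMaxOn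
    ⟨_, hmem⟩ hcont
  have hξ0 : ξ ≠ 0 := ne_zero_of_mem_unit_sphere ⟨ξ, hξ⟩
  set M := ⟪η, ξ⟫_ℝ / p ξ with hM
  have hle : ∀ x, x ≠ 0 → ⟪η, x⟫_ℝ ≤ M * p x := by
    intro x hx
    have hnx : 0 < ‖x‖ := norm_pos_iff.2 hx
    have h1 : ⟪η, ‖x‖⁻¹ • x⟫_ℝ / p (‖x‖⁻¹ • x) ≤ M := hmax (by simp [norm_smul, hnx.ne'])
    rw [hp.homogeneous _ (inv_pos.2 hnx) x hx, real_inner_smul_right,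
      mul_div_mul_left _ _ (inv_ne_zero hnx.ne'), div_le_iff₀ (hp.pos x hx)] at h1
    exact h1
  have hMpos : 0 < M := by
    have h1 := hle η hη
    have h2 : 0 < ⟪η, η⟫_ℝ := real_inner_self_pos.2 hη
    exact pos_of_mul_pos_left (h2.trans_le h1) (hp.pos η hη).le
  -- This function is nonnegative off the origin and vanishes at `ξ`; its critical point equation is
  -- `M ∇p(ξ) = η`.
  have hlocal : IsLocalMin (fun x => M * p x - ⟪η, x⟫_ℝ) ξ := by
    filter_upwards [isOpen_compl_singleton.mem_nhds hξ0] with x hx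
    have h1 := hle x hx
    have h2 : M * p ξ = ⟪η, ξ⟫_ℝ := div_mul_cancel₀ _ (hp.pos ξ hξ0).ne'
    linarith
  have hd : HasFDerivAt (fun x => M * p x - ⟪η, x⟫_ℝ) (M • fderiv ℝ p ξ - innerSL ℝ η) ξ :=
    ((hp.hasFDerivAt hξ0).const_mul M).sub (innerSL ℝ η).hasFDerivAt
  have hgrad : M • gradient p ξ = η := by
    refine ext_inner_right ℝ fun v => ?_
    have h := congrArg (fun L => L v) (hlocal.hasFDerivAt_eq_zero hd)
    rw [real_inner_smul_left, inner_gradient_left]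
    simpa [sub_eq_zero] using h
  have hpos := hp.pos ξ hξ0
  have ht : 0 < M / p ξ := div_pos hMpos hpos
  -- Since `L(tξ) = t p(ξ) ∇p(ξ)`, this scaling produces the factor `M`.
  refine ⟨(M / p ξ) • ξ, smul_ne_zero ht.ne' hξ0, ?_⟩
  rw [hp.legendreMap_smul hξ0 ht, legendreMap, smul_smul, div_mul_cancel₀ _ hpos.ne', hgrad]

end IsPosHomSmooth

/-! ### The inverse Legendre map and the dual function. -/

/-- The inverse, away from the origin, of the Legendre map of `p`. -/
noncomputable def legendreInv (p : EuclideanSpace ℝ (Fin n) → ℝ) :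
    EuclideanSpace ℝ (Fin n) → EuclideanSpace ℝ (Fin n) :=
  Function.invFunOn (legendreMap p) {0}ᶜ

/-- The dual function of `p`. -/
noncomputable def dualFunction (p : EuclideanSpace ℝ (Fin n) → ℝ)
    (η : EuclideanSpace ℝ (Fin n)) : ℝ :=
  p (legendreInv p η)

namespace IsPosHomSmooth

variable {p : EuclideanSpace ℝ (Fin n) → ℝ} {η : EuclideanSpace ℝ (Fin n)}

theorem legendreInv_ne_zero (hp : IsPosHomSmooth p) (hη : η ≠ 0) : legendreInv p η ≠ 0 :=
  Function.invFunOn_mem (hp.legendreMap_surjOn hη)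

theorem legendreMap_legendreInv (hp : IsPosHomSmooth p) (hη : η ≠ 0) :
    legendreMap p (legendreInv p η) = η :=
  Function.invFunOn_eq (hp.legendreMap_surjOn hη)

theorem legendreInv_legendreMap (hp : IsPosHomSmooth p) (hinj : InjOn (legendreMap p) {0}ᶜ)
    {ξ : EuclideanSpace ℝ (Fin n)} (hξ : ξ ≠ 0) : legendreInv p (legendreMap p ξ) = ξ :=
  hinj (hp.legendreInv_ne_zero (hp.legendreMap_ne_zero hξ)) hξ
    (hp.legendreMap_legendreInv (hp.legendreMap_ne_zero hξ))

theorem legendreInv_smul (hp : IsPosHomSmooth p) (hinj : InjOn (legendreMap p) {0}ᶜ)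
    (hη : η ≠ 0) {t : ℝ} (ht : 0 < t) : legendreInv p (t • η) = t • legendreInv p η := by
  have h0 := hp.legendreInv_ne_zero hη
  rw [← hp.legendreInv_legendreMap hinj (smul_ne_zero ht.ne' h0), hp.legendreMap_smul h0 ht,
    hp.legendreMap_legendreInv hη]

theorem contDiffAt_legendreInv (hp : IsPosHomSmooth p) (hinj : InjOn (legendreMap p) {0}ᶜ)
    (hnd : ∀ ξ, ξ ≠ 0 → ∀ v, fderiv ℝ (legendreMap p) ξ v = 0 → v = 0) (hη : η ≠ 0) :
    ContDiffAt ℝ ∞ (legendreInv p) η := by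
  have hξ := hp.legendreInv_ne_zero hη
  set ξ := legendreInv p η with hξdef
  have hGξ : legendreMap p ξ = η := hp.legendreMap_legendreInv hη
  let D : EuclideanSpace ℝ (Fin n) ≃L[ℝ] EuclideanSpace ℝ (Fin n) :=
    (LinearEquiv.ofInjectiveEndo (fderiv ℝ (legendreMap p) ξ).toLinearMap
      ((injective_iff_map_eq_zero _).2 (hnd ξ hξ))).toContinuousLinearEquiv
  have hD : HasFDerivAt (legendreMap p)
      (D : EuclideanSpace ℝ (Fin n) →L[ℝ] EuclideanSpace ℝ (Fin n)) ξ := by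
    have hDeq : (D : EuclideanSpace ℝ (Fin n) →L[ℝ] EuclideanSpace ℝ (Fin n)) =
        fderiv ℝ (legendreMap p) ξ := by
      ext1 v
      rfl
    rw [hDeq]
    exact hp.hasFDerivAt_legendreMap hξ
  have hG := hp.contDiffAt_legendreMap hξ
  have hs := hG.hasStrictFDerivAt' hD (by simp)
  have hsmooth : ContDiffAt ℝ ∞ (hs.localInverse _ _ _) η := by
    rw [← hGξ]
    exact hG.to_localInverse hD (by simp)
  have hright := hs.eventually_right_inverse
  have hne := hs.localInverse_tendsto.eventually_ne hξ
  rw [hGξ] at hright hne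
  -- Global injectivity identifies `legendreInv p` with the local inverse, which stays nonzero near
  -- `η`.
  refine hsmooth.congr_of_eventuallyEq ?_
  filter_upwards [hright, hne, isOpen_compl_singleton.mem_nhds hη] with y hy hy0 hyne
  exact hinj (hp.legendreInv_ne_zero hyne) hy0 ((hp.legendreMap_legendreInv hyne).trans hy.symm)

theorem dualFunction_isPosHomSmooth (hp : IsPosHomSmooth p) (hinj : InjOn (legendreMap p) {0}ᶜ)
    (hnd : ∀ ξ, ξ ≠ 0 → ∀ v, fderiv ℝ (legendreMap p) ξ v = 0 → v = 0) :
    IsPosHomSmooth (dualFunction p) where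
  smooth η hη := ((hp.contDiffAt (hp.legendreInv_ne_zero hη)).comp η
    (hp.contDiffAt_legendreInv hinj hnd hη)).contDiffWithinAt
  pos η hη := hp.pos _ (hp.legendreInv_ne_zero hη)
  homogeneous t ht η hη := by
    rw [dualFunction, hp.legendreInv_smul hinj hη ht,
      hp.homogeneous t ht _ (hp.legendreInv_ne_zero hη), dualFunction]

/-- The Legendre map of the dual function inverts the Legendre map. -/
theorem legendreMap_dualFunction (hp : IsPosHomSmooth p) (hinj : InjOn (legendreMap p) {0}ᶜ)
    (hnd : ∀ ξ, ξ ≠ 0 → ∀ v, fderiv ℝ (legendreMap p) ξ v = 0 → v = 0) (hη : η ≠ 0) :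
    legendreMap (dualFunction p) η = legendreInv p η := by
  have hr := (hp.dualFunction_isPosHomSmooth hinj hnd).hasFDerivAt hη
  have hξ := hp.legendreInv_ne_zero hη
  have hH : HasFDerivAt (legendreInv p) (fderiv ℝ (legendreInv p) η) η :=
    ((hp.contDiffAt_legendreInv hinj hnd hη).differentiableAt (by simp)).hasFDerivAt
  refine ext_inner_right ℝ fun v => ?_
  rw [legendreMap, real_inner_smul_left, inner_gradient_left]
  have h1 : fderiv ℝ (dualFunction p) η v =
      fderiv ℝ p (legendreInv p η) (fderiv ℝ (legendreInv p) η v) :=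
    congrArg (fun L => L v) (hr.unique ((hp.hasFDerivAt hξ).comp η hH))
  have h2 : ⟪η, fderiv ℝ (legendreInv p) η v⟫_ℝ =
      dualFunction p η * fderiv ℝ (dualFunction p) η v := by
    rw [h1, ← inner_gradient_left, ← real_inner_smul_left]
    exact congrArg (fun w => ⟪w, fderiv ℝ (legendreInv p) η v⟫_ℝ)
      (hp.legendreMap_legendreInv hη).symm
  -- Euler's identity at `legendreInv p y`. In its derivative, `h2` turns the term containing
  -- `D(L⁻¹)` into half of the right-hand side.
  have h3 : (fun y => ⟪legendreInv p y, y⟫_ℝ) =ᶠ[𝓝 η] fun y => dualFunction p y ^ 2 := by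
    filter_upwards [isOpen_compl_singleton.mem_nhds hη] with y hy
    have h := hp.inner_legendreMap_self (hp.legendreInv_ne_zero hy)
    rwa [hp.legendreMap_legendreInv hy, real_inner_comm] at h
  have h4 := congrArg (fun L => L v)
    ((hH.inner ℝ (hasFDerivAt_id η)).unique ((hr.pow 2).congr_of_eventuallyEq h3))
  have h5 : ⟪legendreInv p η, v⟫_ℝ + ⟪fderiv ℝ (legendreInv p) η v, η⟫_ℝ =
      2 * dualFunction p η * fderiv ℝ (dualFunction p) η v := by
    simpa [fderivInnerCLM_apply] using h4
  rw [real_inner_comm η, h2] at h5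
  linarith

/-- The chain rule for `L ∘ L⁻¹ = id` gives the derivative a left inverse. -/
theorem fderiv_legendreMap_dualFunction_injective (hp : IsPosHomSmooth p)
    (hinj : InjOn (legendreMap p) {0}ᶜ)
    (hnd : ∀ ξ, ξ ≠ 0 → ∀ v, fderiv ℝ (legendreMap p) ξ v = 0 → v = 0) (hη : η ≠ 0)
    (v : EuclideanSpace ℝ (Fin n)) (hv : fderiv ℝ (legendreMap (dualFunction p)) η v = 0) :
    v = 0 := by
  have hdual := hp.dualFunction_isPosHomSmooth hinj hnd
  have hξ : legendreMap (dualFunction p) η ≠ 0 := hdual.legendreMap_ne_zero hη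
  have hcomp := (hp.hasFDerivAt_legendreMap hξ).comp η (hdual.hasFDerivAt_legendreMap hη)
  have hid : legendreMap p ∘ legendreMap (dualFunction p) =ᶠ[𝓝 η] id := by
    filter_upwards [isOpen_compl_singleton.mem_nhds hη] with y hy
    rw [Function.comp_apply, hp.legendreMap_dualFunction hinj hnd hy,
      hp.legendreMap_legendreInv hy, id]
  have h := congrArg (fun L => L v)
    (hcomp.unique ((hasFDerivAt_id η).congr_of_eventuallyEq hid))
  simpa [hv] using h.symm

theorem legendreMap_eq_gradient (q : EuclideanSpace ℝ (Fin n) → ℝ) {ξ : EuclideanSpace ℝ (Fin n)}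
    (hξ : ξ ∈ unitLevelSet q) : legendreMap q ξ = gradient q ξ := by
  rw [legendreMap, hξ.2, one_smul]

theorem isSmoothOnSubset_gradient (hp : IsPosHomSmooth p) :
    IsSmoothOnSubset (gradient p) (unitLevelSet p) := fun _ hx =>
  ⟨{0}ᶜ, gradient p, isOpen_compl_singleton, hx.1,
    fun _ hy => (hp.contDiffAt hy).gradient_infty.contDiffWithinAt, fun _ _ => rfl⟩

/-- Nonvanishing curvature of the unit level set makes the Legendre map nondegenerate away from
the origin. -/
theorem fderiv_legendreMap_injective (hp : IsPosHomSmooth p)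
    (hcurv : ∀ ξ ∈ unitLevelSet p, gaussianCurvature p ξ ≠ 0) (ξ : EuclideanSpace ℝ (Fin n))
    (hξ : ξ ≠ 0) (v : EuclideanSpace ℝ (Fin n)) (hv : fderiv ℝ (legendreMap p) ξ v = 0) :
    v = 0 := by
  have hpos := hp.pos ξ hξ
  have ht : 0 < (p ξ)⁻¹ := inv_pos.2 hpos
  have hx : (p ξ)⁻¹ • ξ ≠ 0 := smul_ne_zero ht.ne' hξ
  have hmem : (p ξ)⁻¹ • ξ ∈ unitLevelSet p :=
    ⟨hx, by rw [hp.homogeneous _ ht ξ hξ, inv_mul_cancel₀ hpos.ne']⟩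
  refine (hp.gaussianCurvature_ne_zero_iff hx).1 (hcurv _ hmem) v ?_
  -- Differentiating `L(cy) = c L(y)` at `ξ`, with `c = 1/p(ξ)`, gives `DL(cξ) = DL(ξ)`.
  have h1 := (hp.hasFDerivAt_legendreMap hx).comp ξ
    ((hasFDerivAt_id ξ).const_smul (p ξ)⁻¹)
  have h2 := (hp.hasFDerivAt_legendreMap hξ).const_smul (p ξ)⁻¹
  have h3 := h1.unique (h2.congr_of_eventuallyEq (by
    filter_upwards [isOpen_compl_singleton.mem_nhds hξ] with y hy
    exact hp.legendreMap_smul hy ht))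
  have h4 := congrArg (fun L => L v) h3
  simpa [hv, hpos.ne'] using h4

end IsPosHomSmooth

/-! ### Restriction to the unit level sets. -/

theorem theorem3p1 (n : ℕ) (hn : 2 ≤ n) (p : EuclideanSpace ℝ (Fin n) → ℝ)
    (hp : IsPosHomSmooth p)
    (hcurv : ∀ ξ ∈ unitLevelSet p, gaussianCurvature p ξ ≠ 0) :
    ∃ pstar : EuclideanSpace ℝ (Fin n) → ℝ,
      IsPosHomSmooth pstar ∧
      dualLevelSet p = unitLevelSet pstar ∧
      dualLevelSet pstar = unitLevelSet p ∧
      (∀ η ∈ unitLevelSet pstar, gaussianCurvature pstar η ≠ 0) ∧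
      IsDiffeoWithInverse (gradient p) (gradient pstar) (unitLevelSet p) (unitLevelSet pstar) := by
  have hnd := hp.fderiv_legendreMap_injective hcurv
  have hinj := hp.legendreMap_injOn fun ξ hξ v hv => hp.fderiv_legendreMap_pos hn hnd hξ hv
  have hdual := hp.dualFunction_isPosHomSmooth hinj hnd
  have hgrad : ∀ ξ ∈ unitLevelSet p, gradient p ξ = legendreMap p ξ := fun ξ hξ =>
    (IsPosHomSmooth.legendreMap_eq_gradient p hξ).symm
  have hgrad' : ∀ η ∈ unitLevelSet (dualFunction p),
      gradient (dualFunction p) η = legendreInv p η := fun η hη => by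
    rw [← IsPosHomSmooth.legendreMap_eq_gradient _ hη, hp.legendreMap_dualFunction hinj hnd hη.1]
  have hmaps : MapsTo (gradient p) (unitLevelSet p) (unitLevelSet (dualFunction p)) := by
    intro ξ hξ
    rw [hgrad ξ hξ]
    refine ⟨hp.legendreMap_ne_zero hξ.1, ?_⟩
    rw [dualFunction, hp.legendreInv_legendreMap hinj hξ.1, hξ.2]
  have hmaps' : MapsTo (gradient (dualFunction p)) (unitLevelSet (dualFunction p))
      (unitLevelSet p) := by
    intro η hη
    rw [hgrad' η hη]
    exact ⟨hp.legendreInv_ne_zero hη.1, hη.2⟩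
  have hinv : InvOn (gradient (dualFunction p)) (gradient p) (unitLevelSet p)
      (unitLevelSet (dualFunction p)) := by
    constructor
    · intro ξ hξ
      rw [hgrad' _ (hmaps hξ), hgrad ξ hξ, hp.legendreInv_legendreMap hinj hξ.1]
    · intro η hη
      rw [hgrad _ (hmaps' hη), hgrad' η hη, hp.legendreMap_legendreInv hη.1]
  have hbij := hinv.bijOn hmaps hmaps'
  have hbij' := hinv.symm.bijOn hmaps' hmaps
  refine ⟨dualFunction p, hdual, hbij.image_eq, hbij'.image_eq, fun η hη => ?_, ?_⟩
  · exact (hdual.gaussianCurvature_ne_zero_iff hη.1).2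
      (hp.fderiv_legendreMap_dualFunction_injective hinj hnd hη.1)
  · exact ⟨hmaps, hmaps', hinv, hp.isSmoothOnSubset_gradient, hdual.isSmoothOnSubset_gradient⟩
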